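/- Let $\mathbb{X}$ be a finite non-empty metric space and $\mathbb{Y}$ a Polish space, both with their Borel $\sigma$-algebras. Let $\mathcal{T}$ be a stochastic kernel from $\mathbb{X}$ to $\mathbb{X}$ (the transition kernel of the hidden Markov chain) and $\mathcal{Q}$ a stochastic kernel from $\mathbb{X}$ to $\mathbb{Y}$ (the observation channel). Let $\mathcal{Z}=\mathbb{P}(\mathbb{X})$ be the space of probability measures on $\mathbb{X}$ with the weak topology and its Borel $\sigma$-algebra. For $z\in\mathcal{Z}$ let $X_0\sim z$, $X_1\sim\mathcal{T}(\cdot\mid X_0)$, $Y_1\sim\mathcal{Q}(\cdot\mid X_1)$, and let $F(z,y)(\cdot)=\Pr\{X_1\in\cdot\mid Y_1=y\}$ be a version, jointly measurable in $(z,y)$, of the regular conditional distribution of $X_1$ given $Y_1=y$. The filter process is the Markov process on $\mathcal{Z}$ with transition kernel $$\eta(A\mid z)=\int_{\mathbb{X}}\int_{\mathbb{X}}\int_{\mathbb{Y}}\mathbf{1}_{\{F(z,y)\in A\}}\,\mathcal{Q}(dy\mid x_1)\,\mathcal{T}(dx_1\mid x_0)\,z(dx_0),\qquad A\subseteq\mathcal{Z}\text{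 Borel},$$ which does not depend on the version of $F$. Suppose that the filter process has a topologically reachable state, that is, there is $z^*\in\mathcal{Z}$ such that for every $z\in\mathcal{Z}$ and every open neighborhood $O$ of $z^*$ there exists an integer $k>0$ with $\eta^k(O\mid z)>0$. Then the filter process is uniquely ergodic: there exists exactly one probability measure $\nu$ on $\mathcal{Z}$ with $\int_{\mathcal{Z}}\eta(A\mid z)\,\nu(dz)=\nu(A)$ for every Borel set $A\subseteq\mathcal{Z}$. -/

import Mathlib

open MeasureTheory ProbabilityTheory

/-- A state `x` of a Markov chain with transition kernel `P` is topologically reachable if every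
open neighborhood `O` of `x` is hit with positive probability at some time `k > 0`, from every
initial state `y`. -/
def IsTopologicallyReachable {S : Type*} [MeasurableSpace S] [TopologicalSpace S]
    (P : Kernel S S) (x : S) : Prop :=
  ∀ y : S, ∀ O : Set S, IsOpen O → x ∈ O → ∃ k : ℕ, 0 < k ∧ 0 < (P ^ k) y O

/-- A Markov chain with transition kernel `P` is uniquely ergodic if it has exactly one invariant
probability measure. -/
def IsUniquelyErgodic {S : Type*} [MeasurableSpace S] (P : Kernel S S) : Prop :=
  ∃! ν : ProbabilityMeasure S, P.Invariant (ν : Measure S)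

section HiddenMarkovModel

variable {X Y : Type*} [MeasurableSpace X] [MeasurableSpace Y]

/-- The kernel from `ProbabilityMeasure X` to `X` that draws a point from the law `z`. -/
noncomputable def drawKernel (X : Type*) [MeasurableSpace X] : Kernel (ProbabilityMeasure X) X where
  toFun z := (z : Measure X)
  measurable' := measurable_subtype_coe

instance : IsMarkovKernel (drawKernel X) :=
  ⟨fun z => inferInstanceAs (IsProbabilityMeasure (z : Measure X))⟩

/-- The joint law of the next observation and the next hidden state `(Y₁, X₁)`, as a kernel in the
law `z` of the current hidden state: `X₀ ∼ z`, `X₁ ∼ T(· | X₀)`, `Y₁ ∼ Q(· | X₁)`. -/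
noncomputable def obsStateKernel (T : Kernel X X) (Q : Kernel X Y) :
    Kernel (ProbabilityMeasure X) (Y × X) :=
  (Q ×ₖ Kernel.id) ∘ₖ (T ∘ₖ drawKernel X)

instance (T : Kernel X X) (Q : Kernel X Y) [IsMarkovKernel T] [IsMarkovKernel Q] :
    IsMarkovKernel (obsStateKernel T Q) := by
  unfold obsStateKernel; infer_instance

variable [StandardBorelSpace X] [Nonempty X] [StandardBorelSpace Y]

/-- The filter update `F(z, y) = Pr(X₁ ∈ · | Z₀ = z, Y₁ = y)`: the regular conditional distribution
of `X₁` given `Y₁ = y` when the current hidden state has law `z`. It is determined up to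
observations `y` that have probability zero under `z`, which do not affect `filterKernel`. -/
noncomputable def filterUpdate (T : Kernel X X) (Q : Kernel X Y)
    [IsMarkovKernel T] [IsMarkovKernel Q] (p : ProbabilityMeasure X × Y) : ProbabilityMeasure X :=
  ⟨(obsStateKernel T Q).condKernel p, inferInstance⟩

theorem measurable_filterUpdate (T : Kernel X X) (Q : Kernel X Y)
    [IsMarkovKernel T] [IsMarkovKernel Q] : Measurable (filterUpdate T Q) :=
  (Kernel.measurable _).subtype_mk

/-- The transition kernel `η` of the filter process: `η(· | z)` is the law of `F(z, Y₁)`, where the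
next observation `Y₁` is distributed as `∫∫ Q(· | x₁) T(dx₁ | x₀) z(dx₀)`. -/
noncomputable def filterKernel (T : Kernel X X) (Q : Kernel X Y)
    [IsMarkovKernel T] [IsMarkovKernel Q] :
    Kernel (ProbabilityMeasure X) (ProbabilityMeasure X) :=
  (Kernel.id ×ₖ (Q ∘ₖ (T ∘ₖ drawKernel X))).map (filterUpdate T Q)

instance (T : Kernel X X) (Q : Kernel X Y) [IsMarkovKernel T] [IsMarkovKernel Q] :
    IsMarkovKernel (filterKernel T Q) :=
  Kernel.IsMarkovKernel.map _ (measurable_filterUpdate T Q)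

end HiddenMarkovModel

/-! Extend `f` on the simplex to the positive cone by homogeneity, `a • z ↦ a * f z`. Normalizing in
Bayes' formula makes the filter update nonlinear, but the unnormalized posterior is linear in the
prior, and the filter operator at `z` is the integral over observations of the extended `f` at that
posterior. A stochastic matrix does not increase the `ℓ¹` norm and observation densities integrate
to one, so the `ℓ¹` Lipschitz constant of the extension never grows
(`IsHomogeneousLipschitz.markovOperator_filterKernel`). Hence the iterates of a Lipschitz function
are equi-Lipschitz, for every `T` and `Q`.

The simplex is compact, so by Arzelà–Ascoli Cesàro averages of the iterates have a continuous
harmonic limit point (`exists_harmonic_tendsto_markovAverage`). By the maximum principle, a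
reachable state forces it to be constant, and every invariant probability measure then gives `f`
that constant as integral (`integral_eq_of_invariant`). Existence is Krylov–Bogoliubov
(`exists_invariant`). -/

/-! ### Unique ergodicity from equi-Lipschitz iterates on a compact metric space. -/

section MarkovOperator

open Filter Topology NNReal Kernel

variable {S : Type*} [MeasurableSpace S]

/-- The Markov operator of a kernel `P`, mapping `f` to `x ↦ ∫ f(y) P(dy | x)`. -/
noncomputable def markovOperator (P : Kernel S S) (f : S → ℝ) (x : S) : ℝ := ∫ y, f y ∂P x

theorem abs_integral_le_of_forall_abs_le {μ : Measure S} [IsProbabilityMeasure μ] {f : S → ℝ}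
    {M : ℝ} (hf : ∀ x, |f x| ≤ M) : |∫ x, f x ∂μ| ≤ M := by
  simpa using norm_integral_le_of_norm_le_const (μ := μ) (f := f) (.of_forall hf)

theorem abs_iterate_markovOperator_le (P : Kernel S S) [IsMarkovKernel P] {f : S → ℝ} {M : ℝ}
    (hf : ∀ x, |f x| ≤ M) (k : ℕ) (x : S) : |(markovOperator P)^[k] f x| ≤ M := by
  induction k generalizing x with
  | zero => exact hf x
  | succ k ih =>
    rw [Function.iterate_succ_apply']
    exact abs_integral_le_of_forall_abs_le ih

/-- The Cesàro averages of the iterates of the Markov operator. -/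
noncomputable def markovAverage (P : Kernel S S) (f : S → ℝ) (n : ℕ) (x : S) : ℝ :=
  ((n : ℝ) + 1)⁻¹ * ∑ k ∈ Finset.range (n + 1), (markovOperator P)^[k] f x

theorem abs_inv_mul_sum_le {a : ℕ → ℝ} {M : ℝ} (h : ∀ k, |a k| ≤ M) (n : ℕ) :
    |((n : ℝ) + 1)⁻¹ * ∑ k ∈ Finset.range (n + 1), a k| ≤ M := by
  have h1 : |∑ k ∈ Finset.range (n + 1), a k| ≤ ((n : ℝ) + 1) * M := by
    refine (Finset.abs_sum_le_sum_abs _ _).trans ((Finset.sum_le_sum fun k _ => h k).trans ?_)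
    simp
  rw [abs_mul, abs_of_pos (by positivity : (0 : ℝ) < ((n : ℝ) + 1)⁻¹)]
  exact (inv_mul_le_iff₀ (by positivity)).2 h1

theorem tendsto_inv_mul_sub_zero {a : ℕ → ℝ} {M : ℝ} (h : ∀ k, |a k| ≤ M) :
    Tendsto (fun n : ℕ => ((n : ℝ) + 1)⁻¹ * (a (n + 1) - a 0)) atTop (𝓝 0) := by
  have h0 : Tendsto (fun n : ℕ => ((n : ℝ) + 1)⁻¹) atTop (𝓝 0) := by
    simpa using tendsto_one_div_add_atTop_nhds_zero_nat (𝕜 := ℝ)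
  refine h0.zero_mul_isBoundedUnder_le (isBoundedUnder_of ⟨2 * M, fun n => ?_⟩)
  have := abs_sub (a (n + 1)) (a 0)
  simp only [Function.comp_apply, Real.norm_eq_abs]
  linarith [h (n + 1), h 0]

theorem LipschitzWith.exists_abs_le_of_compactSpace {S : Type*} [MetricSpace S] [CompactSpace S]
    {K : ℝ≥0} {f : S → ℝ} (hf : LipschitzWith K f) : ∃ M, ∀ x, |f x| ≤ M :=
  ⟨_, fun x => (BoundedContinuousFunction.mkOfCompact ⟨f, hf.continuous⟩).norm_coe_le_norm x⟩

variable [MetricSpace S]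

theorem continuous_markovAverage {P : Kernel S S} {f : S → ℝ}
    (hf : ∀ k, Continuous ((markovOperator P)^[k] f)) (n : ℕ) :
    Continuous (markovAverage P f n) :=
  continuous_const.mul (continuous_finsetSum _ fun k _ => hf k)

theorem lipschitzWith_markovAverage {P : Kernel S S} {f : S → ℝ} {K : ℝ≥0}
    (hf : ∀ k, LipschitzWith K ((markovOperator P)^[k] f)) (n : ℕ) :
    LipschitzWith K (markovAverage P f n) := by
  refine LipschitzWith.of_dist_le_mul fun x y => ?_
  rw [Real.dist_eq, markovAverage, markovAverage, ← mul_sub, ← Finset.sum_sub_distrib]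
  exact abs_inv_mul_sum_le
    (a := fun k => (markovOperator P)^[k] f x - (markovOperator P)^[k] f y)
    (fun k => (hf k).dist_le_mul x y) n

variable [BorelSpace S]

/-- Weak convergence can be tested on bounded Lipschitz functions, so the constant sequence `μ`
converges to `ν`; the weak topology is Hausdorff. -/
theorem probabilityMeasure_eq_of_forall_lipschitzWith {μ ν : ProbabilityMeasure S}
    (h : ∀ K : ℝ≥0, ∀ f : S → ℝ, LipschitzWith K f → ∫ x, f x ∂μ = ∫ x, f x ∂ν) : μ = ν := by
  have h1 : Tendsto (fun _ : ℕ => μ) atTop (𝓝 ν) := by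
    rw [tendsto_iff_forall_lipschitz_integral_tendsto]
    rintro f - ⟨K, hf⟩
    rw [h K f hf]
    exact tendsto_const_nhds
  exact tendsto_nhds_unique tendsto_const_nhds h1

variable [CompactSpace S]

theorem Continuous.integrable_of_compactSpace {f : S → ℝ} (hf : Continuous f) (μ : Measure S)
    [IsFiniteMeasure μ] : Integrable f μ :=
  hf.integrable_of_hasCompactSupport (.of_compactSpace f)

theorem integral_bind_of_continuous (P : Kernel S S) [IsMarkovKernel P] (μ : Measure S)
    [IsProbabilityMeasure μ] {f : S → ℝ} (hf : Continuous f) :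
    ∫ x, f x ∂(μ.bind P) = ∫ x, markovOperator P f x ∂μ :=
  Kernel.integral_comp (κ := Kernel.const Unit μ) (a := ()) (η := P)
    (hf.integrable_of_compactSpace (P ∘ₘ μ))

theorem integral_iterate_markovOperator {P : Kernel S S} [IsMarkovKernel P] {ν : Measure S}
    [IsProbabilityMeasure ν] (hν : P.Invariant ν) {f : S → ℝ}
    (hf : ∀ k, Continuous ((markovOperator P)^[k] f)) (k : ℕ) :
    ∫ x, (markovOperator P)^[k] f x ∂ν = ∫ x, f x ∂ν := by
  induction k with
  | zero => rfl
  | succ k ih =>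
    simp_rw [Function.iterate_succ_apply']
    rw [← integral_bind_of_continuous P ν (hf k), hν.def, ih]

/-- The two conclusions share one induction: the integral step needs the lower power to be a
probability measure, and uses the hypothesis for `markovOperator P f`. -/
theorem integral_pow_of_continuous (P : Kernel S S) [IsMarkovKernel P] {f : S → ℝ}
    (hf : ∀ k, Continuous ((markovOperator P)^[k] f)) (k : ℕ) (x : S) :
    IsProbabilityMeasure ((P ^ k) x) ∧ ∫ y, f y ∂(P ^ k) x = (markovOperator P)^[k] f x := by
  induction k generalizing f with
  | zero =>
    have : (P ^ 0) x = Measure.dirac x := Kernel.id_apply x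
    rw [this]
    exact ⟨inferInstance, by simp [integral_dirac]⟩
  | succ k ih =>
    have := (ih hf).1
    have h1 : (P ^ (k + 1)) x = ((P ^ k) x).bind P := by
      rw [pow_succ']
      exact Kernel.comp_apply P (P ^ k) x
    rw [h1]
    refine ⟨inferInstanceAs (IsProbabilityMeasure (P ∘ₘ (P ^ k) x)), ?_⟩
    rw [integral_bind_of_continuous P _ (f := f) (hf 0)]
    have h2 : ∀ k, Continuous ((markovOperator P)^[k] (markovOperator P f)) := fun k => hf (k + 1)
    simpa using (ih h2).2

theorem integral_markovAverage {P : Kernel S S} {f : S → ℝ}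
    (hf : ∀ k, Continuous ((markovOperator P)^[k] f)) (n : ℕ) (μ : Measure S) [IsFiniteMeasure μ] :
    ∫ x, markovAverage P f n x ∂μ =
      ((n : ℝ) + 1)⁻¹ * ∑ k ∈ Finset.range (n + 1), ∫ x, (markovOperator P)^[k] f x ∂μ := by
  unfold markovAverage
  rw [integral_const_mul, integral_finsetSum _ fun k _ => (hf k).integrable_of_compactSpace μ]

/-- Telescoping. The error term is `O(1 / n)` for bounded `f`, which makes limits of the averages
harmonic. -/
theorem markovOperator_markovAverage {P : Kernel S S} [IsMarkovKernel P] {f : S → ℝ}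
    (hf : ∀ k, Continuous ((markovOperator P)^[k] f)) (n : ℕ) (x : S) :
    markovOperator P (markovAverage P f n) x = markovAverage P f n x +
      ((n : ℝ) + 1)⁻¹ * ((markovOperator P)^[n + 1] f x - (markovOperator P)^[0] f x) := by
  have h1 : ∀ k, ∫ y, (markovOperator P)^[k] f y ∂P x = (markovOperator P)^[k + 1] f x := fun k => by
    rw [Function.iterate_succ_apply']; rfl
  rw [markovOperator, integral_markovAverage hf]
  simp_rw [h1]
  rw [markovAverage, ← mul_add, ← Finset.sum_range_sub (fun k => (markovOperator P)^[k] f x),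
    ← Finset.sum_add_distrib]
  simp

/-- A subsequence of the Cesàro averages converges to a continuous harmonic function. -/
theorem exists_harmonic_tendsto_markovAverage {P : Kernel S S} [IsMarkovKernel P] {f : S → ℝ}
    {K : ℝ≥0} (hf : ∀ k, LipschitzWith K ((markovOperator P)^[k] f)) :
    ∃ g : S → ℝ, ∃ φ : ℕ → ℕ, Continuous g ∧ markovOperator P g = g ∧
      ∀ μ : Measure S, IsProbabilityMeasure μ →
        Tendsto (fun n => ∫ x, markovAverage P f (φ n) x ∂μ) atTop (𝓝 (∫ x, g x ∂μ)) := by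
  have hc : ∀ k, Continuous ((markovOperator P)^[k] f) := fun k => (hf k).continuous
  obtain ⟨M, hM⟩ := (hf 0).exists_abs_le_of_compactSpace
  have hMk := abs_iterate_markovOperator_le P hM
  have hMA : ∀ n x, |markovAverage P f n x| ≤ M := fun n x =>
    abs_inv_mul_sum_le (fun k => hMk k x) n
  let a : ℕ → BoundedContinuousFunction S ℝ := fun n =>
    .mkOfCompact ⟨markovAverage P f n, continuous_markovAverage hc n⟩
  have hcomp : IsCompact (closure (Set.range a)) := by
    refine BoundedContinuousFunction.arzela_ascoli (Set.Icc (-M) M) isCompact_Icc _ ?_ ?_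
    · rintro _ x ⟨n, rfl⟩
      exact abs_le.1 (hMA n x)
    · refine (LipschitzWith.uniformEquicontinuous _ K ?_).equicontinuous
      rintro ⟨_, n, rfl⟩
      exact lipschitzWith_markovAverage hf n
  obtain ⟨g, -, φ, hφ, hlim⟩ := hcomp.tendsto_subseq fun n => subset_closure ⟨n, rfl⟩
  have hpt : ∀ x, Tendsto (fun n => markovAverage P f (φ n) x) atTop (𝓝 (g x)) := fun x =>
    ((BoundedContinuousFunction.lipschitz_eval_const x).continuous.tendsto g).comp hlim
  have hint : ∀ μ : Measure S, IsProbabilityMeasure μ →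
      Tendsto (fun n => ∫ x, markovAverage P f (φ n) x ∂μ) atTop (𝓝 (∫ x, g x ∂μ)) := by
    intro μ hμ
    exact tendsto_integral_of_dominated_convergence (fun _ => M)
      (fun n => (continuous_markovAverage hc _).aestronglyMeasurable)
      (integrable_const M) (fun n => .of_forall (hMA _)) (.of_forall hpt)
  refine ⟨g, φ, g.continuous, funext fun x => ?_, hint⟩
  have h1 : Tendsto (fun n => markovOperator P (markovAverage P f (φ n)) x) atTop
      (𝓝 (markovOperator P g x)) := hint (P x) inferInstance
  refine tendsto_nhds_unique h1 ?_
  simp_rw [markovOperator_markovAverage hc]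
  simpa using (hpt x).add ((tendsto_inv_mul_sub_zero
    (a := fun k => (markovOperator P)^[k] f x) (hMk · x)).comp hφ.tendsto_atTop)

/-- The maximum principle at a topologically reachable state. -/
theorem le_apply_of_isTopologicallyReachable {P : Kernel S S} [IsMarkovKernel P] {z : S}
    (hz : IsTopologicallyReachable P z) {g : S → ℝ} (hg : Continuous g)
    (hPg : markovOperator P g = g) (x : S) : g x ≤ g z := by
  have : Nonempty S := ⟨z⟩
  obtain ⟨m, -, hm⟩ := isCompact_univ.exists_isMaxOn Set.univ_nonempty hg.continuousOn
  have hmax : ∀ y, g y ≤ g m := fun y => hm (Set.mem_univ y)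
  have hiter : ∀ k, (markovOperator P)^[k] g = g := fun k => Function.iterate_fixed hPg k
  by_contra! hlt
  have hzm : g z < g m := hlt.trans_le (hmax x)
  -- Started at the maximum point `m`, the chain reaches this neighborhood of `z` with positive
  -- probability, which would push the mean of `g` strictly below `g m`.
  obtain ⟨k, -, hk⟩ := hz m {y | g y < g m} (isOpen_lt hg continuous_const) hzm
  obtain ⟨hprob, hk2⟩ := integral_pow_of_continuous P (fun k => by rw [hiter k]; exact hg) k m
  rw [hiter k] at hk2
  have h0 : ∫ y, (g m - g y) ∂(P ^ k) m = 0 := by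
    rw [integral_sub (integrable_const _) (hg.integrable_of_compactSpace _), hk2]
    simp
  rw [integral_eq_zero_iff_of_nonneg (fun y => sub_nonneg.2 (hmax y))
    ((continuous_const.sub hg).integrable_of_compactSpace _)] at h0
  refine hk.ne' (measure_mono_null (fun y hy => ?_) h0)
  exact (sub_pos.2 hy).ne'

theorem exists_eq_const_of_isTopologicallyReachable {P : Kernel S S} [IsMarkovKernel P] {z : S}
    (hz : IsTopologicallyReachable P z) {g : S → ℝ} (hg : Continuous g)
    (hPg : markovOperator P g = g) : ∃ c, g = fun _ => c := by
  refine ⟨g z, funext fun x =>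
    le_antisymm (le_apply_of_isTopologicallyReachable hz hg hPg x) ?_⟩
  have hneg : markovOperator P (fun y => -g y) = fun y => -g y := by
    ext x
    rw [markovOperator, integral_neg, neg_inj]
    exact congrFun hPg x
  exact neg_le_neg_iff.1 (le_apply_of_isTopologicallyReachable hz hg.neg hneg x)

/-- Averaging does not change the integral against an invariant measure, while the averages converge
to a constant that does not depend on the measure. -/
theorem integral_eq_of_invariant {P : Kernel S S} [IsMarkovKernel P] {z : S}
    (hz : IsTopologicallyReachable P z) {f : S → ℝ} {K : ℝ≥0}
    (hf : ∀ k, LipschitzWith K ((markovOperator P)^[k] f)) {μ ν : Measure S}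
    [IsProbabilityMeasure μ] [IsProbabilityMeasure ν] (hμ : P.Invariant μ) (hν : P.Invariant ν) :
    ∫ x, f x ∂μ = ∫ x, f x ∂ν := by
  have hc : ∀ k, Continuous ((markovOperator P)^[k] f) := fun k => (hf k).continuous
  obtain ⟨g, φ, hg, hPg, hlim⟩ := exists_harmonic_tendsto_markovAverage hf
  obtain ⟨c, rfl⟩ := exists_eq_const_of_isTopologicallyReachable hz hg hPg
  have key : ∀ ρ : Measure S, IsProbabilityMeasure ρ → P.Invariant ρ → ∫ x, f x ∂ρ = c := by
    intro ρ _ hρ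
    have h1 : ∀ n, ∫ x, markovAverage P f n x ∂ρ = ∫ x, f x ∂ρ := fun n => by
      rw [integral_markovAverage hc]
      simp_rw [integral_iterate_markovOperator hρ hc]
      have : (n : ℝ) + 1 ≠ 0 := by positivity
      simp [this]
    have h2 := hlim ρ inferInstance
    simp_rw [h1] at h2
    simpa using tendsto_nhds_unique tendsto_const_nhds h2
  rw [key μ inferInstance hμ, key ν inferInstance hν]

/-- The law of the state at a uniformly chosen time in `{0, …, n}`. -/
noncomputable def averageLaw (P : Kernel S S) (x : S) (n : ℕ) : Measure S :=
  ((n : ENNReal) + 1)⁻¹ • ∑ k ∈ Finset.range (n + 1), (P ^ k) x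

theorem isProbabilityMeasure_averageLaw (P : Kernel S S) [IsMarkovKernel P] (x : S) (n : ℕ) :
    IsProbabilityMeasure (averageLaw P x n) := by
  have h1 : ∀ k, (P ^ k) x Set.univ = 1 := fun k => by
    -- The zero function serves only to extract the probability-measure conclusion.
    have := (integral_pow_of_continuous P (f := fun _ => (0 : ℝ)) (fun k => by
      have : (markovOperator P)^[k] (fun _ => (0 : ℝ)) = fun _ => 0 :=
        Function.iterate_fixed (by ext; simp [markovOperator]) k
      rw [this]; exact continuous_const) k x).1
    exact measure_univ
  constructor
  rw [averageLaw, Measure.smul_apply, Measure.finsetSum_apply]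
  simp only [h1, Finset.sum_const, Finset.card_range, smul_eq_mul, nsmul_eq_mul, mul_one]
  push_cast
  exact ENNReal.inv_mul_cancel (by simp) (by finiteness)

theorem integral_averageLaw (P : Kernel S S) [IsMarkovKernel P] {f : S → ℝ}
    (hf : ∀ k, Continuous ((markovOperator P)^[k] f)) (x : S) (n : ℕ) :
    ∫ y, f y ∂averageLaw P x n = markovAverage P f n x := by
  rw [averageLaw, integral_smul_measure, integral_finsetSum_measure, markovAverage]
  · simp_rw [fun k => (integral_pow_of_continuous P hf k x).2]
    rw [ENNReal.toReal_inv, ENNReal.toReal_add (by finiteness) (by finiteness)]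
    simp
  · intro k _
    have := (integral_pow_of_continuous P hf k x).1
    exact (hf 0).integrable_of_compactSpace _

/-- Krylov–Bogoliubov: at a weak limit point of the averaged laws, `f` and `markovOperator P f` have
equal integrals by telescoping. The hypothesis supplies the Feller continuity. -/
theorem exists_invariant [Nonempty S] (P : Kernel S S) [IsMarkovKernel P]
    (hP : ∀ K : ℝ≥0, ∀ f : S → ℝ, LipschitzWith K f →
      ∃ K' : ℝ≥0, ∀ k, LipschitzWith K' ((markovOperator P)^[k] f)) :
    ∃ μ : ProbabilityMeasure S, P.Invariant (μ : Measure S) := by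
  obtain ⟨x⟩ := ‹Nonempty S›
  let u : ℕ → ProbabilityMeasure S := fun n =>
    ⟨averageLaw P x n, isProbabilityMeasure_averageLaw P x n⟩
  obtain ⟨μ, -, φ, hφ, hμ⟩ := isCompact_univ.tendsto_subseq (x := u) fun n => Set.mem_univ _
  refine ⟨μ, ?_⟩
  have hb : IsProbabilityMeasure ((μ : Measure S).bind P) :=
    inferInstanceAs (IsProbabilityMeasure (P ∘ₘ (μ : Measure S)))
  suffices h : (⟨(μ : Measure S).bind P, hb⟩ : ProbabilityMeasure S) = μ from
    congrArg Subtype.val h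
  refine probabilityMeasure_eq_of_forall_lipschitzWith fun K f hf => ?_
  obtain ⟨K', hK'⟩ := hP K f hf
  have hc : ∀ k, Continuous ((markovOperator P)^[k] f) := fun k => (hK' k).continuous
  have hc' : ∀ k, Continuous ((markovOperator P)^[k] (markovOperator P f)) := fun k => hc (k + 1)
  obtain ⟨M, hM⟩ := hf.exists_abs_le_of_compactSpace
  have hlim : ∀ h : S → ℝ, (∀ k, Continuous ((markovOperator P)^[k] h)) →
      Tendsto (fun n => markovAverage P h (φ n) x) atTop (𝓝 (∫ y, h y ∂(μ : Measure S))) := by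
    intro h hh
    have := ProbabilityMeasure.tendsto_iff_forall_integral_tendsto.1 hμ
      (BoundedContinuousFunction.mkOfCompact ⟨h, hh 0⟩)
    exact this.congr fun n => integral_averageLaw P hh x (φ n)
  change ∫ y, f y ∂((μ : Measure S).bind P) = _
  rw [integral_bind_of_continuous P _ (f := f) (hc 0)]
  refine tendsto_nhds_unique (hlim _ hc') ?_
  have h1 : ∀ n, markovAverage P (markovOperator P f) n x = markovAverage P f n x +
      ((n : ℝ) + 1)⁻¹ * ((markovOperator P)^[n + 1] f x - (markovOperator P)^[0] f x) := fun n => by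
    rw [← markovOperator_markovAverage hc, markovOperator, integral_markovAverage hc]
    unfold markovAverage
    congr 1
    refine Finset.sum_congr rfl fun k _ => ?_
    rw [← Function.iterate_succ_apply, Function.iterate_succ_apply']
    rfl
  simp_rw [h1]
  simpa using (hlim f hc).add ((tendsto_inv_mul_sub_zero
    (a := fun k => (markovOperator P)^[k] f x)
    (abs_iterate_markovOperator_le P hM · x)).comp hφ.tendsto_atTop)

/-- A Markov chain on a compact metric space whose iterated Markov operator preserves
equi-Lipschitz families and that has a topologically reachable state is uniquely ergodic. -/
theorem isUniquelyErgodic_of_isTopologicallyReachable {P : Kernel S S} [IsMarkovKernel P]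
    (hP : ∀ K : ℝ≥0, ∀ f : S → ℝ, LipschitzWith K f →
      ∃ K' : ℝ≥0, ∀ k, LipschitzWith K' ((markovOperator P)^[k] f))
    {z : S} (hz : IsTopologicallyReachable P z) : IsUniquelyErgodic P := by
  have : Nonempty S := ⟨z⟩
  obtain ⟨μ, hμ⟩ := exists_invariant P hP
  refine ⟨μ, hμ, fun ν hν => probabilityMeasure_eq_of_forall_lipschitzWith fun K f hf => ?_⟩
  obtain ⟨K', hK'⟩ := hP K f hf
  exact integral_eq_of_invariant hz hK' hν hμ

end MarkovOperator

/-! ### The simplex: topology and Borel structure of the probability measures on a finite space. -/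

section ProbabilityVector

open Topology

variable {X : Type*} [MeasurableSpace X]

/-- The vector of point masses of a probability measure. -/
noncomputable def probabilityVector (z : ProbabilityMeasure X) (x : X) : ℝ :=
  (z : Measure X).real {x}

theorem probabilityVector_nonneg (z : ProbabilityMeasure X) (x : X) : 0 ≤ probabilityVector z x :=
  measureReal_nonneg

theorem probabilityVector_injective [Countable X] :
    Function.Injective (probabilityVector : ProbabilityMeasure X → X → ℝ) := fun z w h => by
  refine ProbabilityMeasure.toMeasure_injective (Measure.ext_of_singleton fun x => ?_)
  exact (measureReal_eq_measureReal_iff (by finiteness) (by finiteness)).1 (congrFun h x)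

variable [MeasurableSingletonClass X]

theorem measurable_probabilityVector :
    Measurable (probabilityVector : ProbabilityMeasure X → X → ℝ) :=
  measurable_pi_iff.2 fun x =>
    ((Measure.measurable_coe (measurableSet_singleton x)).comp measurable_subtype_coe).ennreal_toReal

variable [Fintype X]

theorem sum_probabilityVector (z : ProbabilityMeasure X) : ∑ x, probabilityVector z x = 1 := by
  simp only [probabilityVector, sum_measureReal_singleton, Finset.coe_univ, probReal_univ]

/-- On a finite space the mass of any set is a finite sum of coordinates, so the coordinates
generate all evaluations. -/
theorem measurableSpace_probabilityMeasure_eq_comap :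
    (inferInstance : MeasurableSpace (ProbabilityMeasure X)) =
      MeasurableSpace.comap probabilityVector inferInstance := by
  refine le_antisymm ?_ measurable_probabilityVector.comap_le
  have h : Measurable[MeasurableSpace.comap (probabilityVector (X := X)) inferInstance]
      (fun z : ProbabilityMeasure X => (z : Measure X)) := by
    refine @Measure.measurable_of_measurable_coe _ _ _ (_) _ fun s _ => ?_
    have h1 : (fun z : ProbabilityMeasure X => (z : Measure X) s) =
        (fun v : X → ℝ => ENNReal.ofReal (∑ x ∈ s.toFinite.toFinset, v x)) ∘
          probabilityVector := by
      ext z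
      simp only [Function.comp_apply, probabilityVector, sum_measureReal_singleton]
      simp
    rw [h1]
    exact (Measurable.ennreal_ofReal (Finset.measurable_fun_sum _ fun x _ =>
      measurable_pi_apply x)).comp (comap_measurable _)
  exact h.comap_le.trans' (by rfl)

variable [TopologicalSpace X] [DiscreteTopology X] [OpensMeasurableSpace X]

theorem continuous_probabilityVector :
    Continuous (probabilityVector : ProbabilityMeasure X → X → ℝ) := by
  refine continuous_pi fun x => ?_
  have h := ProbabilityMeasure.continuous_integral_boundedContinuousFunction
    (BoundedContinuousFunction.mkOfCompact
      ⟨Set.indicator {x} (fun _ : X => (1 : ℝ)), continuous_of_discreteTopology⟩)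
  refine h.congr fun z => ?_
  exact integral_indicator_one (measurableSet_singleton x)

theorem isClosedEmbedding_probabilityVector [BorelSpace X] :
    IsClosedEmbedding (probabilityVector : ProbabilityMeasure X → X → ℝ) :=
  continuous_probabilityVector.isClosedEmbedding probabilityVector_injective

theorem borelSpace_probabilityMeasure [BorelSpace X] : BorelSpace (ProbabilityMeasure X) := by
  refine ⟨?_⟩
  rw [isClosedEmbedding_probabilityVector.isInducing.eq_induced, borel_comap,
    ← BorelSpace.measurable_eq]
  exact measurableSpace_probabilityMeasure_eq_comap

end ProbabilityVector

/-! ### Observation densities and Bayes' formula. -/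

section FilterDensity

open scoped ENNReal

variable {X Y : Type*} [MeasurableSpace X] [MeasurableSpace Y] [Fintype X]

/-- A finite measure dominating all the observation laws. -/
noncomputable def obsRefMeasure (Q : Kernel X Y) : Measure Y := ∑ x, Q x

/-- The density of the observation law at a hidden state with respect to `obsRefMeasure`. -/
noncomputable def obsDensity (Q : Kernel X Y) (x : X) : Y → ℝ≥0∞ := (Q x).rnDeriv (obsRefMeasure Q)

/-- The law of the next hidden state when the current one has law `z`. -/
noncomputable def predictedLaw (T : Kernel X X) (z : ProbabilityMeasure X) : Measure X :=
  (T ∘ₖ drawKernel X) z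

/-- The density of the law of the next observation when the current hidden state has law `z`. -/
noncomputable def predictedDensity (T : Kernel X X) (Q : Kernel X Y) (z : ProbabilityMeasure X)
    (y : Y) : ℝ≥0∞ :=
  ∑ x, predictedLaw T z {x} * obsDensity Q x y

instance (Q : Kernel X Y) [IsMarkovKernel Q] : IsFiniteMeasure (obsRefMeasure Q) := by
  unfold obsRefMeasure; infer_instance

theorem measurable_obsDensity (Q : Kernel X Y) (x : X) : Measurable (obsDensity Q x) :=
  Measure.measurable_rnDeriv _ _

theorem measurable_predictedDensity (T : Kernel X X) (Q : Kernel X Y) (z : ProbabilityMeasure X) :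
    Measurable (predictedDensity T Q z) :=
  Finset.measurable_fun_sum _ fun x _ => (measurable_obsDensity Q x).const_mul _

theorem withDensity_obsDensity (Q : Kernel X Y) [IsMarkovKernel Q] (x : X) :
    (obsRefMeasure Q).withDensity (obsDensity Q x) = Q x := by
  refine Measure.withDensity_rnDeriv_eq _ _ (Measure.absolutelyContinuous_of_le ?_)
  exact Finset.single_le_sum (f := fun x => Q x) (fun _ _ => Measure.zero_le _) (Finset.mem_univ x)

theorem setLIntegral_obsDensity (Q : Kernel X Y) [IsMarkovKernel Q] (x : X) {A : Set Y}
    (hA : MeasurableSet A) : ∫⁻ y in A, obsDensity Q x y ∂obsRefMeasure Q = Q x A := by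
  rw [← withDensity_apply _ hA, withDensity_obsDensity]

theorem integrable_obsDensity (Q : Kernel X Y) [IsMarkovKernel Q] (x : X) :
    Integrable (fun y => (obsDensity Q x y).toReal) (obsRefMeasure Q) :=
  Measure.integrable_toReal_rnDeriv

theorem integral_obsDensity (Q : Kernel X Y) [IsMarkovKernel Q] (x : X) :
    ∫ y, (obsDensity Q x y).toReal ∂obsRefMeasure Q = 1 := by
  rw [integral_toReal (measurable_obsDensity Q x).aemeasurable (Measure.rnDeriv_lt_top _ _),
    ← setLIntegral_univ, setLIntegral_obsDensity Q x .univ]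
  simp

instance (T : Kernel X X) [IsMarkovKernel T] (z : ProbabilityMeasure X) :
    IsProbabilityMeasure (predictedLaw T z) :=
  inferInstanceAs (IsProbabilityMeasure ((T ∘ₖ drawKernel X) z))

theorem fst_obsStateKernel {X Y : Type*} [MeasurableSpace X] [MeasurableSpace Y]
    (T : Kernel X X) (Q : Kernel X Y) [IsMarkovKernel Q] :
    (obsStateKernel T Q).fst = Q ∘ₖ (T ∘ₖ drawKernel X) := by
  rw [obsStateKernel, Kernel.fst_comp, Kernel.fst_prod]

theorem ae_obsDensity_lt_top (Q : Kernel X Y) [IsMarkovKernel Q] :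
    ∀ᵐ y ∂obsRefMeasure Q, ∀ x, obsDensity Q x y < ∞ :=
  ae_all_iff.2 fun _ => Measure.rnDeriv_lt_top _ _

theorem predictedDensity_lt_top (T : Kernel X X) [IsMarkovKernel T] (z : ProbabilityMeasure X)
    (Q : Kernel X Y) {y : Y} (hy : ∀ x, obsDensity Q x y < ∞) : predictedDensity T Q z y < ∞ :=
  ENNReal.sum_lt_top.2 fun x _ => ENNReal.mul_lt_top (measure_lt_top _ _) (hy x)

theorem comp_drawKernel_apply (T : Kernel X X) (z : ProbabilityMeasure X)
    (Q : Kernel X Y) [IsMarkovKernel Q] [MeasurableSingletonClass X] :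
    (Q ∘ₖ (T ∘ₖ drawKernel X)) z = (obsRefMeasure Q).withDensity (predictedDensity T Q z) := by
  ext A hA
  rw [withDensity_apply _ hA, Kernel.comp_apply' _ _ _ hA, lintegral_fintype]
  simp_rw [predictedDensity]
  rw [lintegral_finsetSum _ fun x _ => (measurable_obsDensity Q x).const_mul _]
  refine Finset.sum_congr rfl fun x _ => ?_
  rw [lintegral_const_mul _ (measurable_obsDensity Q x), setLIntegral_obsDensity Q x hA, mul_comm]
  rfl

theorem obsStateKernel_prod_singleton (T : Kernel X X) (z : ProbabilityMeasure X) (Q : Kernel X Y)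
    [IsMarkovKernel Q] [MeasurableSingletonClass X] (x : X) {A : Set Y} (hA : MeasurableSet A) :
    obsStateKernel T Q z (A ×ˢ {x}) = predictedLaw T z {x} * Q x A := by
  classical
  rw [obsStateKernel, Kernel.comp_apply' _ _ _ (hA.prod (measurableSet_singleton x)),
    lintegral_fintype, Finset.sum_eq_single x]
  · rw [Kernel.prod_apply, Measure.prod_prod, Kernel.id_apply]
    simp [mul_comm, predictedLaw]
  · intro b _ hb
    rw [Kernel.prod_apply, Measure.prod_prod, Kernel.id_apply]
    simp [hb]
  · simp

variable (T : Kernel X X) [IsMarkovKernel T] (z : ProbabilityMeasure X)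

variable [MeasurableSingletonClass X]

theorem predictedLaw_real_singleton (x : X) :
    (predictedLaw T z).real {x} = ∑ x', probabilityVector z x' * (T x').real {x} := by
  rw [measureReal_def, predictedLaw, Kernel.comp_apply' _ _ _ (measurableSet_singleton x),
    lintegral_fintype, ENNReal.toReal_sum (fun _ _ => by finiteness)]
  refine Finset.sum_congr rfl fun x' _ => ?_
  rw [ENNReal.toReal_mul, mul_comm]
  rfl

variable (Q : Kernel X Y) [IsMarkovKernel Q]

variable [Nonempty X] [StandardBorelSpace X] [StandardBorelSpace Y]

theorem setLIntegral_filterUpdate (x : X) {A : Set Y} (hA : MeasurableSet A) :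
    ∫⁻ y in A, (filterUpdate T Q (z, y) : Measure X) {x} ∂(Q ∘ₖ (T ∘ₖ drawKernel X)) z =
      predictedLaw T z {x} * Q x A := by
  rw [← obsStateKernel_prod_singleton T z Q x hA]
  conv_rhs => rw [← (obsStateKernel T Q).disintegrate (obsStateKernel T Q).condKernel]
  rw [Kernel.compProd_apply_prod hA (measurableSet_singleton x), fst_obsStateKernel]
  rfl

/-- Bayes' formula for the filter update. -/
theorem ae_predictedDensity_mul_filterUpdate :
    ∀ᵐ y ∂obsRefMeasure Q, ∀ x,
      (predictedDensity T Q z y).toReal * probabilityVector (filterUpdate T Q (z, y)) x =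
        (predictedLaw T z).real {x} * (obsDensity Q x y).toReal := by
  refine ae_all_iff.2 fun x => ?_
  have hF : Measurable fun y => (filterUpdate T Q (z, y) : Measure X) {x} :=
    (Measure.measurable_coe (measurableSet_singleton x)).comp
      (measurable_subtype_coe.comp ((measurable_filterUpdate T Q).comp measurable_prodMk_left))
  have h : (fun y => predictedDensity T Q z y * (filterUpdate T Q (z, y) : Measure X) {x})
      =ᵐ[obsRefMeasure Q] fun y => predictedLaw T z {x} * obsDensity Q x y := by
    refine ae_eq_of_forall_setLIntegral_eq_of_sigmaFinite
      ((measurable_predictedDensity T Q z).mul hF) ((measurable_obsDensity Q x).const_mul _)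
      fun A hA _ => ?_
    rw [lintegral_const_mul _ (measurable_obsDensity Q x), setLIntegral_obsDensity Q x hA,
      ← setLIntegral_filterUpdate T z Q x hA, comp_drawKernel_apply,
      setLIntegral_withDensity_eq_setLIntegral_mul _ (measurable_predictedDensity T Q z) hF hA]
    rfl
  filter_upwards [h] with y hy
  have := congrArg ENNReal.toReal hy
  simpa only [ENNReal.toReal_mul, probabilityVector, measureReal_def] using this

/-- The weight `predictedDensity` is the total mass of the unnormalized posterior, so the integrand
is the homogeneous extension of `f` at that posterior. -/
theorem markovOperator_filterKernel {f : ProbabilityMeasure X → ℝ} (hf : Measurable f) :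
    markovOperator (filterKernel T Q) f z =
      ∫ y, (predictedDensity T Q z y).toReal * f (filterUpdate T Q (z, y)) ∂obsRefMeasure Q := by
  have hF := measurable_filterUpdate T Q
  have hfF : Measurable fun p => f (filterUpdate T Q p) := hf.comp hF
  rw [markovOperator, filterKernel, Kernel.map_apply _ hF,
    integral_map hF.aemeasurable hf.aestronglyMeasurable, Kernel.prod_apply, Kernel.id_apply,
    Measure.dirac_prod, integral_map measurable_prodMk_left.aemeasurable hfF.aestronglyMeasurable,
    comp_drawKernel_apply,
    integral_withDensity_eq_integral_toReal_smul (measurable_predictedDensity T Q z)]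
  · rfl
  · filter_upwards [ae_obsDensity_lt_top Q] with y hy
    exact predictedDensity_lt_top T z Q hy

end FilterDensity

/-! ### Nonexpansiveness on the positive cone. -/

section HomogeneousLipschitz

variable {X : Type*} [MeasurableSpace X] [Fintype X]

/-- A function on the simplex whose positively homogeneous extension to the positive cone is
Lipschitz for the `ℓ¹` norm with constant `L`. -/
def IsHomogeneousLipschitz (L : ℝ) (f : ProbabilityMeasure X → ℝ) : Prop :=
  ∀ (a b : ℝ) (z w : ProbabilityMeasure X), 0 ≤ a → 0 ≤ b →
    |a * f z - b * f w| ≤ L * ∑ x, |a * probabilityVector z x - b * probabilityVector w x|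

variable [MeasurableSingletonClass X] {L : ℝ} {f : ProbabilityMeasure X → ℝ}

theorem abs_sub_le_sum_abs (a b : ℝ) (z w : ProbabilityMeasure X) :
    |a - b| ≤ ∑ x, |a * probabilityVector z x - b * probabilityVector w x| := by
  have h : a - b = ∑ x, (a * probabilityVector z x - b * probabilityVector w x) := by
    rw [Finset.sum_sub_distrib, ← Finset.mul_sum, ← Finset.mul_sum, sum_probabilityVector,
      sum_probabilityVector, mul_one, mul_one]
  rw [h]
  exact Finset.abs_sum_le_sum_abs _ _

theorem IsHomogeneousLipschitz.abs_le (hf : IsHomogeneousLipschitz L f)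
    (z : ProbabilityMeasure X) : |f z| ≤ L := by
  have h := hf 1 0 z z zero_le_one le_rfl
  simp only [one_mul, zero_mul, sub_zero, abs_of_nonneg (probabilityVector_nonneg z _),
    sum_probabilityVector, mul_one] at h
  exact h

/-- Split `a * f z - b * f w` as `a * (f z - f w) + (a - b) * f w`. Since `a • (z - w) = (a • z - b
• w) - (a - b) • w` and `|a - b| ≤ Δ`, the first term costs `2 * K * Δ` and the second `M * Δ`. -/
theorem isHomogeneousLipschitz_of_abs_sub_le {K M : ℝ} (hK : 0 ≤ K) (hM : ∀ z, |f z| ≤ M)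
    (hf : ∀ z w, |f z - f w| ≤ K * ∑ x, |probabilityVector z x - probabilityVector w x|) :
    IsHomogeneousLipschitz (2 * K + M) f := by
  intro a b z w ha _
  set Δ := ∑ x, |a * probabilityVector z x - b * probabilityVector w x|
  have hab : |a - b| ≤ Δ := abs_sub_le_sum_abs a b z w
  have h1 : a * ∑ x, |probabilityVector z x - probabilityVector w x| ≤ Δ + |a - b| := by
    have : |a - b| = ∑ x, |a - b| * probabilityVector w x := by
      rw [← Finset.mul_sum, sum_probabilityVector, mul_one]
    rw [this, Finset.mul_sum, ← Finset.sum_add_distrib]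
    refine Finset.sum_le_sum fun x _ => ?_
    calc a * |probabilityVector z x - probabilityVector w x|
        = |(a * probabilityVector z x - b * probabilityVector w x) -
            (a - b) * probabilityVector w x| := by
          rw [← abs_of_nonneg ha, ← abs_mul, abs_of_nonneg ha]; congr 1; ring
      _ ≤ _ := (abs_sub _ _).trans_eq (by
          rw [abs_mul (a - b), abs_of_nonneg (probabilityVector_nonneg w x)])
  calc |a * f z - b * f w| = |a * (f z - f w) + (a - b) * f w| := by congr 1; ring
    _ ≤ a * |f z - f w| + |a - b| * |f w| := by
        refine (abs_add_le _ _).trans_eq ?_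
        rw [abs_mul, abs_mul, abs_of_nonneg ha]
    _ ≤ a * (K * ∑ x, |probabilityVector z x - probabilityVector w x|) + Δ * M := by
        gcongr
        · exact hf z w
        · exact hM w
    _ = K * (a * ∑ x, |probabilityVector z x - probabilityVector w x|) + Δ * M := by ring
    _ ≤ K * (Δ + Δ) + Δ * M := by gcongr; linarith
    _ = (2 * K + M) * Δ := by ring

theorem sum_abs_predictedLaw_le (T : Kernel X X) [IsMarkovKernel T] (a b : ℝ)
    (z w : ProbabilityMeasure X) :
    ∑ x, |a * (predictedLaw T z).real {x} - b * (predictedLaw T w).real {x}| ≤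
      ∑ x, |a * probabilityVector z x - b * probabilityVector w x| := by
  calc ∑ x, |a * (predictedLaw T z).real {x} - b * (predictedLaw T w).real {x}|
      ≤ ∑ x, ∑ x', |a * probabilityVector z x' - b * probabilityVector w x'| * (T x').real {x} := by
        refine Finset.sum_le_sum fun x _ => ?_
        rw [predictedLaw_real_singleton, predictedLaw_real_singleton, Finset.mul_sum,
          Finset.mul_sum, ← Finset.sum_sub_distrib]
        refine (Finset.abs_sum_le_sum_abs _ _).trans_eq (Finset.sum_congr rfl fun x' _ => ?_)
        rw [← abs_of_nonneg (measureReal_nonneg : 0 ≤ (T x').real {x}), ← abs_mul,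
          abs_of_nonneg measureReal_nonneg]
        congr 1; ring
    _ = _ := by
        rw [Finset.sum_comm]
        refine Finset.sum_congr rfl fun x' _ => ?_
        rw [← Finset.mul_sum, sum_measureReal_singleton]
        simp

variable {Y : Type*} [MeasurableSpace Y] [Nonempty X] [StandardBorelSpace X] [StandardBorelSpace Y]

/-- The filter kernel is nonexpansive for the homogeneous Lipschitz constant. -/
theorem IsHomogeneousLipschitz.markovOperator_filterKernel (hf : IsHomogeneousLipschitz L f)
    (hfm : Measurable f) (T : Kernel X X) [IsMarkovKernel T] (Q : Kernel X Y) [IsMarkovKernel Q] :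
    IsHomogeneousLipschitz L (markovOperator (filterKernel T Q) f) := by
  intro a b z w ha hb
  have hL : 0 ≤ L := (abs_nonneg _).trans (hf.abs_le z)
  have hd : ∀ v : ProbabilityMeasure X,
      Integrable (fun y => (predictedDensity T Q v y).toReal) (obsRefMeasure Q) := fun v => by
    refine integrable_toReal_of_lintegral_ne_top (measurable_predictedDensity T Q v).aemeasurable ?_
    rw [← setLIntegral_univ, ← withDensity_apply _ .univ, ← comp_drawKernel_apply]
    finiteness
  have hint : ∀ v : ProbabilityMeasure X, Integrable (fun y =>
      (predictedDensity T Q v y).toReal * f (filterUpdate T Q (v, y))) (obsRefMeasure Q) := fun v =>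
    (hd v).mul_bdd (c := L) (hfm.comp ((measurable_filterUpdate T Q).comp
      measurable_prodMk_left)).aestronglyMeasurable (.of_forall fun y => hf.abs_le _)
  rw [_root_.markovOperator_filterKernel T z Q hfm, _root_.markovOperator_filterKernel T w Q hfm,
    ← integral_const_mul, ← integral_const_mul,
    ← integral_sub ((hint z).const_mul a) ((hint w).const_mul b)]
  have hq : ∀ x, Integrable (fun y =>
      |a * (predictedLaw T z).real {x} - b * (predictedLaw T w).real {x}| *
        (obsDensity Q x y).toReal) (obsRefMeasure Q) :=
    fun x => (integrable_obsDensity Q x).const_mul _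
  calc _ ≤ ∫ y, L * ∑ x, |a * (predictedLaw T z).real {x} - b * (predictedLaw T w).real {x}| *
          (obsDensity Q x y).toReal ∂obsRefMeasure Q := by
        rw [← Real.norm_eq_abs]
        refine norm_integral_le_of_norm_le
          ((integrable_finsetSum _ fun x _ => hq x).const_mul L) ?_
        filter_upwards [ae_predictedDensity_mul_filterUpdate T z Q,
          ae_predictedDensity_mul_filterUpdate T w Q] with y hz hw
        -- The scalars absorb the normalizing constants, so Bayes' formula applies without division,
        -- even where the predicted density vanishes.
        have h := hf (a * (predictedDensity T Q z y).toReal) (b * (predictedDensity T Q w y).toReal)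
          (filterUpdate T Q (z, y)) (filterUpdate T Q (w, y)) (by positivity) (by positivity)
        simp only [mul_assoc, hz, hw] at h
        rw [Real.norm_eq_abs]
        refine h.trans_eq ?_
        congr 1
        refine Finset.sum_congr rfl fun x _ => ?_
        rw [← mul_assoc, ← mul_assoc, ← sub_mul, abs_mul, abs_of_nonneg ENNReal.toReal_nonneg]
    _ = L * ∑ x, |a * (predictedLaw T z).real {x} - b * (predictedLaw T w).real {x}| := by
        rw [integral_const_mul, integral_finsetSum _ fun x _ => hq x]
        simp_rw [integral_const_mul, integral_obsDensity, mul_one]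
    _ ≤ _ := mul_le_mul_of_nonneg_left (sum_abs_predictedLaw_le T a b z w) hL

end HomogeneousLipschitz

/-! ### Equi-Lipschitz iterates of the filter operator, and the conclusion. -/

open scoped NNReal in
theorem exists_lipschitzWith_iterate_markovOperator_filterKernel {X Y : Type*} [Fintype X]
    [MeasurableSpace X] [MeasurableSingletonClass X] [Nonempty X] [StandardBorelSpace X]
    [MeasurableSpace Y] [StandardBorelSpace Y] [MetricSpace (ProbabilityMeasure X)]
    [BorelSpace (ProbabilityMeasure X)]
    (hdist : ∀ z w : ProbabilityMeasure X,
      dist z w = dist (probabilityVector z) (probabilityVector w))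
    (T : Kernel X X) [IsMarkovKernel T] (Q : Kernel X Y) [IsMarkovKernel Q]
    {K : ℝ≥0} {M : ℝ} {f : ProbabilityMeasure X → ℝ} (hf : LipschitzWith K f)
    (hM : ∀ z, |f z| ≤ M) :
    ∃ K' : ℝ≥0, ∀ k, LipschitzWith K' ((markovOperator (filterKernel T Q))^[k] f) := by
  have hlip : ∀ {L : ℝ} {g : ProbabilityMeasure X → ℝ}, IsHomogeneousLipschitz L g →
      LipschitzWith (L * Fintype.card X).toNNReal g := by
    intro L g hg
    refine LipschitzWith.of_dist_le_mul fun z w => ?_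
    have hL : 0 ≤ L := (abs_nonneg _).trans (hg.abs_le z)
    have h := hg 1 1 z w zero_le_one zero_le_one
    simp only [one_mul] at h
    rw [Real.dist_eq, hdist, Real.coe_toNNReal _ (by positivity), mul_assoc]
    refine h.trans (mul_le_mul_of_nonneg_left ?_ hL)
    refine (Finset.sum_le_card_nsmul _ _ (dist (probabilityVector z) (probabilityVector w))
      fun x _ => dist_le_pi_dist (probabilityVector z) (probabilityVector w) x).trans_eq ?_
    simp
  have h0 : IsHomogeneousLipschitz (2 * K + M) f := by
    refine isHomogeneousLipschitz_of_abs_sub_le K.coe_nonneg hM fun z w => ?_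
    refine (hf.dist_le_mul z w).trans (mul_le_mul_of_nonneg_left ?_ K.coe_nonneg)
    rw [hdist]
    refine (dist_pi_le_iff (by positivity)).2 fun x => ?_
    exact Finset.single_le_sum (f := fun x => |probabilityVector z x - probabilityVector w x|)
      (fun _ _ => abs_nonneg _) (Finset.mem_univ x)
  refine ⟨_, fun k => hlip (L := 2 * K + M) ?_⟩
  induction k with
  | zero => exact h0
  | succ k ih =>
    rw [Function.iterate_succ_apply']
    exact ih.markovOperator_filterKernel (hlip ih).continuous.measurable T Q

theorem mainTheorem8
    {X : Type*} [MetricSpace X] [Finite X] [Nonempty X] [MeasurableSpace X] [BorelSpace X]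
    {Y : Type*} [TopologicalSpace Y] [PolishSpace Y] [MeasurableSpace Y] [BorelSpace Y]
    (T : Kernel X X) [IsMarkovKernel T] (Q : Kernel X Y) [IsMarkovKernel Q]
    (h : ∃ z : ProbabilityMeasure X, IsTopologicallyReachable (filterKernel T Q) z) :
    IsUniquelyErgodic (filterKernel T Q) := by
  obtain ⟨z, hz⟩ := h
  have := Fintype.ofFinite X
  have : BorelSpace (ProbabilityMeasure X) := borelSpace_probabilityMeasure
  -- The sup metric on point masses is pulled back along an embedding, so its topology is the weak
  -- one and `hz` still applies.
  let : MetricSpace (ProbabilityMeasure X) :=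
    isClosedEmbedding_probabilityVector.isEmbedding.comapMetricSpace _
  refine isUniquelyErgodic_of_isTopologicallyReachable (fun K f hf => ?_) hz
  obtain ⟨M, hM⟩ := hf.exists_abs_le_of_compactSpace
  exact exists_lipschitzWith_iterate_markovOperator_filterKernel (fun _ _ => rfl) T Q hf hM
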